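/- **Proposition (Tangent bundle under linear near-isometry).** Let $\mathbb{M}\subset\mathbb{R}^n$ be a compact, smooth, boundaryless, $k$-dimensional embedded submanifold (not necessarily connected). For $x\in\mathbb{M}$ let $\mathbb{T}_x\mathbb{M}\subset\mathbb{R}^n$ be the tangent subspace of $\mathbb{M}$ at $x$, i.e. the linear span of the velocities $\gamma'(0)$ of smooth curves $\gamma:[-1,1]\to\mathbb{M}$ with $\gamma(0)=x$, and let $\mathbb{N}_x\mathbb{M}$ be its orthogonal complement in $\mathbb{R}^n$; the same definitions are used for the image $\Phi(\mathbb{M})\subset\mathbb{R}^m$ below. The reach $\mathrm{rch}(\mathbb{M})\in(0,\infty]$ is the largest number such that for all $0<r<\mathrm{rch}(\mathbb{M})$ the open normal bundle $\{(x,v): x\in\mathbb{M},\ v\in\mathbb{N}_x\mathbb{M},\ \|v\|_2<r\}$ is smoothly embedded in $\mathbb{R}^n$ by $(x,v)\mapsto x+v$ (with $1/\mathrm{rch}(\mathbb{M})^2=0$ if $\mathrm{rch}(\mathbb{M})=\infty$). The angle $\angle[\mathbb{A},\mathbb{B}]\in[0,\pi]$ between subspaces is the largest principal angle, given by $\cos\angle[\mathbb{A},\mathbb{B}]=\min_{0\ne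 a\in\mathbb{A}}\max_{0\ne b\in\mathbb{B}}\cos\angle[a,b]$. (If $k=0$ all tangent subspaces are $\{0\}$, and the two angles below are taken to be equal.) Let $0<l\le 1\le u<\infty$, and let $\Phi:\mathbb{R}^n\to\mathbb{R}^m$ be a linear map such that $$l\,\|x-y\|_2\le\|\Phi(x)-\Phi(y)\|_2\le u\,\|x-y\|_2\qquad\text{for all }x,y\in\mathbb{M}.$$ Then for all $p,q\in\mathbb{M}$, $$\left|\cos\left(\angle[\mathbb{T}_{\Phi(p)}\Phi(\mathbb{M}),\mathbb{T}_{\Phi(q)}\Phi(\mathbb{M})]\right)-\cos\left(\angle[\mathbb{T}_p\mathbb{M},\mathbb{T}_q\mathbb{M}]\right)\right|\le\frac{25}{4l^2}\cdot\frac{\|p-q\|_2^2}{\mathrm{rch}(\mathbb{M})^2}\cdot\left(\max(\|\Phi\|^2,u^2)+1\right)^2+\frac{18\max(\Delta,\sqrt{\Delta})}{l^2},$$ where $\Delta=\max(1-l^2,\,u^2-1)$ and $\|\Phi\|$ is the spectral norm of $\Phi$. -/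

import Mathlib

open scoped ContDiff ENNReal

noncomputable section

namespace NearIsometry

variable {E : Type*} [NormedAddCommGroup E] [InnerProductSpace ℝ E]

/-- `M` is a smooth `k`-dimensional (boundaryless, embedded) submanifold of `E`: every point of `M`
has a relatively open neighbourhood `M ∩ U` in `M` that is diffeomorphic to `ℝᵏ`. Here `φ` is the
diffeomorphism from `ℝᵏ` onto `M ∩ U` and (the restriction of) `ψ` is its smooth inverse.
Transition maps `ψ' ∘ φ` are then automatically smooth. -/
def IsSmoothSubmanifold (k : ℕ) (M : Set E) : Prop :=
  ∀ x ∈ M, ∃ (U : Set E) (φ : EuclideanSpace ℝ (Fin k) → E) (ψ : E → EuclideanSpace ℝ (Fin k)),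
    IsOpen U ∧ x ∈ U ∧ ContDiff ℝ ∞ φ ∧ ContDiffOn ℝ ∞ ψ U ∧
      Set.range φ = M ∩ U ∧ ∀ z, ψ (φ z) = z

/-- The tangent subspace of `M` at `x`: the span of the velocities at time `0` of all smooth curves
`γ : [-1, 1] → M` with `γ 0 = x`. -/
def tangentSubspace (M : Set E) (x : E) : Submodule ℝ E :=
  Submodule.span ℝ {v : E | ∃ γ : ℝ → E, ContDiffOn ℝ ∞ γ (Set.Icc (-1) 1) ∧
    (∀ t ∈ Set.Icc (-1 : ℝ) 1, γ t ∈ M) ∧ γ 0 = x ∧ HasDerivAt γ v 0}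

/-- The normal subspace of `M` at `x`. -/
def normalSubspace (M : Set E) (x : E) : Submodule ℝ E :=
  (tangentSubspace M x)ᗮ

/-- The open normal bundle of radius `r`: pairs of a base point `x ∈ M` and a normal vector at `x`
of length less than `r`. -/
def openNormalBundle (M : Set E) (r : ℝ) : Set (E × E) :=
  {z | z.1 ∈ M ∧ z.2 ∈ normalSubspace M z.1 ∧ ‖z.2‖ < r}

/-- The open normal bundle of radius `r` is (smoothly) embedded in `E` by the endpoint map
`(x, v) ↦ x + v`. The bundle has the same dimension as `E`, so this says that the endpoint map is a
diffeomorphism onto an open subset of `E`; `g` is its smooth inverse. -/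
def NormalBundleEmbedded (M : Set E) (r : ℝ) : Prop :=
  IsOpen ((fun z : E × E => z.1 + z.2) '' openNormalBundle M r) ∧
    ∃ g : E → E × E,
      ContDiffOn ℝ ∞ g ((fun z : E × E => z.1 + z.2) '' openNormalBundle M r) ∧
        ∀ z ∈ openNormalBundle M r, g (z.1 + z.2) = z

/-- The reach of `M`: the largest `r ∈ [0, ∞]` such that the open normal bundle of radius `s` is
embedded for all `0 < s < r`. -/
def reach (M : Set E) : ℝ≥0∞ :=
  sSup {r : ℝ≥0∞ | ∀ s : ℝ, 0 < s → ENNReal.ofReal s < r → NormalBundleEmbedded M s}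

/-- The (largest principal) angle between the subspaces `A` and `B`: its cosine is
`min_a max_b cos (∠[a, b])` over nonzero vectors `a ∈ A`, `b ∈ B`. -/
def subspaceAngle (A B : Submodule ℝ E) : ℝ :=
  Real.arccos (⨅ a : {a : E // a ∈ A ∧ a ≠ 0}, ⨆ b : {b : E // b ∈ B ∧ b ≠ 0},
    Real.cos (InnerProductGeometry.angle (a : E) (b : E)))

end NearIsometry

end

namespace NearIsometry

open Filter Topology Asymptotics

variable {E F : Type*} [NormedAddCommGroup E] [InnerProductSpace ℝ E]
  [NormedAddCommGroup F] [InnerProductSpace ℝ F]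

/-! Both cosines are close to 1 when `p` and `q` are close, so they are close to each other. Since
`Φ` is bounded below on chords, tangent spaces of the image are images of tangent spaces. For `s`
below the reach, Federer's inequality (`NormalBundleEmbedded.inner_le`) controls chords. Walking
along a tangent line at `p` (`infDist_line_le`) then puts each tangent vector `a` at `p` within `c *
‖a‖` of the tangent space at `q`, where `c = 5 * ‖p - q‖ / s`. So one cosine is at least `1 - c ^ 2`
and the other at least `1 - (‖Φ‖ * c / l) ^ 2`; letting `s` tend to the reach gives the first term
of the bound, and the `Δ` term is not needed. -/

/-! ### Charts and tangent spaces under a linear map. -/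

/-- A submanifold has, near every point, a smooth parametrization with locally Lipschitz inverse. -/
theorem IsSmoothSubmanifold.exists_parametrization {k : ℕ} {M : Set E}
    (hM : IsSmoothSubmanifold k M) {x : E} (hx : x ∈ M) :
    ∃ (φ : EuclideanSpace ℝ (Fin k) → E) (x₀ : EuclideanSpace ℝ (Fin k)),
      ContDiff ℝ ∞ φ ∧ φ x₀ = x ∧ (∀ z, φ z ∈ M) ∧
      ∃ C : ℝ, ∀ᶠ y in 𝓝[M] x, ∃ z, φ z = y ∧ ‖z - x₀‖ ≤ C * ‖y - x‖ := by
  obtain ⟨U, φ, ψ, hU, hxU, hφ, hψ, hr, hinv⟩ := hM x hx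
  have hmem : ∀ y ∈ M, y ∈ U → ∃ z, φ z = y := fun y h1 h2 => by
    have : y ∈ Set.range φ := hr ▸ ⟨h1, h2⟩
    exact this
  obtain ⟨x₀, hx₀⟩ := hmem x hx hxU
  refine ⟨φ, x₀, hφ, hx₀, fun z => ?_, ?_⟩
  · have : φ z ∈ M ∩ U := hr ▸ Set.mem_range_self z
    exact this.1
  · have hd : DifferentiableAt ℝ ψ x :=
      (hψ.contDiffAt (hU.mem_nhds hxU)).differentiableAt (by simp)
    obtain ⟨C, hC⟩ := hd.hasFDerivAt.isBigO_sub.bound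
    refine ⟨C, ?_⟩
    filter_upwards [mem_nhdsWithin_of_mem_nhds hC, self_mem_nhdsWithin,
      mem_nhdsWithin_of_mem_nhds (hU.mem_nhds hxU)] with y hy hyM hyU
    obtain ⟨z, rfl⟩ := hmem y hyM hyU
    refine ⟨z, rfl, ?_⟩
    have h0 : ψ x = x₀ := by rw [← hx₀, hinv]
    simpa [hinv, h0] using hy

/-- `v` is a limit of the vectors `L (t⁻¹ • x t)`, and a finite-dimensional range is closed; neither
injectivity of `L` nor convergence of `t⁻¹ • x t` is required. -/
theorem mem_range_of_isLittleO {V : Type*} [NormedAddCommGroup V] [NormedSpace ℝ V]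
    [FiniteDimensional ℝ V] (L : V →L[ℝ] F) (x : ℝ → V) (v : F)
    (h : (fun t => L (x t) - t • v) =o[𝓝[≠] 0] fun t : ℝ => t) : ∃ w, L w = v := by
  have hcl : IsClosed (L.toLinearMap.range : Set F) :=
    Submodule.closed_of_finiteDimensional _
  have hlim : Tendsto (fun t : ℝ => L (t⁻¹ • x t)) (𝓝[≠] 0) (𝓝 v) := by
    rw [tendsto_iff_norm_sub_tendsto_zero]
    have := (isLittleO_iff_tendsto' (f := fun t => ‖L (x t) - t • v‖)
      (g := fun t : ℝ => ‖t‖) (l := 𝓝[≠] 0) ?_).1 h.norm_norm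
    · refine this.congr' ?_
      filter_upwards [self_mem_nhdsWithin] with t ht
      have ht : t ≠ 0 := ht
      have : L (t⁻¹ • x t) - v = t⁻¹ • (L (x t) - t • v) := by
        rw [smul_sub, smul_smul, inv_mul_cancel₀ ht, one_smul, map_smul]
      rw [this, norm_smul, norm_inv, div_eq_inv_mul]
    · filter_upwards [self_mem_nhdsWithin] with t ht h0
      exact absurd (norm_eq_zero.1 h0) ht
  exact hcl.mem_of_tendsto hlim (Eventually.of_forall fun t => ⟨_, rfl⟩)

theorem contDiff_hasDerivAt_comp_line (φ : E → F) (hφ : ContDiff ℝ ∞ φ) (x₀ w : E) :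
    ContDiff ℝ ∞ (fun t : ℝ => φ (x₀ + t • w)) ∧
      HasDerivAt (fun t : ℝ => φ (x₀ + t • w)) (fderiv ℝ φ x₀ w) 0 := by
  refine ⟨hφ.comp (by fun_prop), ?_⟩
  have h1 : HasDerivAt (fun t : ℝ => x₀ + t • w) w 0 := by
    simpa using ((hasDerivAt_id (0 : ℝ)).smul_const w).const_add x₀
  have h2 : HasFDerivAt φ (fderiv ℝ φ x₀) (x₀ + (0 : ℝ) • w) := by
    simpa using (hφ.differentiable (by simp) x₀).hasFDerivAt
  exact h2.comp_hasDerivAt (0 : ℝ) h1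

/-- The image of a submanifold under a linear map that is bounded below on it has, at every point,
the image of the derivative of a chart as its tangent subspace. -/
theorem tangentSubspace_image_eq_range {k : ℕ} {M : Set E} {x : E}
    {φ : EuclideanSpace ℝ (Fin k) → E} {x₀ : EuclideanSpace ℝ (Fin k)}
    (hφ : ContDiff ℝ ∞ φ) (hx₀ : φ x₀ = x) (hφM : ∀ z, φ z ∈ M)
    {C : ℝ} (hC : ∀ᶠ y in 𝓝[M] x, ∃ z, φ z = y ∧ ‖z - x₀‖ ≤ C * ‖y - x‖)
    (Φ : E →L[ℝ] F) {l : ℝ} (hl : 0 < l) (hΦ : ∀ y ∈ M, l * ‖y - x‖ ≤ ‖Φ y - Φ x‖) :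
    tangentSubspace (Φ '' M) (Φ x) = (Φ.comp (fderiv ℝ φ x₀)).toLinearMap.range := by
  apply le_antisymm
  · refine Submodule.span_le.2 ?_
    rintro v ⟨γ, -, hγM, hγ0, hγ⟩
    have hD : HasFDerivAt φ (fderiv ℝ φ x₀) x₀ := (hφ.differentiable (by simp) x₀).hasFDerivAt
    choose! β hβM hβ using hγM
    have hIcc : ∀ᶠ t : ℝ in 𝓝 0, t ∈ Set.Icc (-1 : ℝ) 1 := Icc_mem_nhds (by simp) (by simp)
    -- The lift `β` of `γ` to `M` need not be differentiable; the lower bound on `Φ` only makes it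
    -- O(t), which is enough.
    have hβO : (fun t => β t - x) =O[𝓝 0] fun t : ℝ => t := by
      have h1 : (fun t => γ t - γ 0) =O[𝓝 0] fun t : ℝ => t := by
        simpa using hγ.hasFDerivAt.isBigO_sub
      refine IsBigO.trans (IsBigO.of_bound l⁻¹ ?_) h1
      filter_upwards [hIcc] with t ht
      rw [← hβ t ht, hγ0, inv_mul_eq_div, le_div_iff₀ hl, mul_comm]
      exact hΦ _ (hβM t ht)
    have hβt : Tendsto β (𝓝 0) (𝓝[M] x) := by
      refine tendsto_nhdsWithin_iff.2 ⟨?_, hIcc.mono fun t ht => hβM t ht⟩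
      have := hβO.trans_tendsto (tendsto_id (α := ℝ))
      simpa using this.add_const x
    have hex := hβt.eventually hC
    obtain ⟨z, hz⟩ : ∃ z : ℝ → EuclideanSpace ℝ (Fin k),
        ∀ᶠ t in 𝓝 0, φ (z t) = β t ∧ ‖z t - x₀‖ ≤ C * ‖β t - x‖ := by
      have : ∀ t, ∃ w, (∃ w, φ w = β t ∧ ‖w - x₀‖ ≤ C * ‖β t - x‖) →
          φ w = β t ∧ ‖w - x₀‖ ≤ C * ‖β t - x‖ := fun t => by
        by_cases h : ∃ w, φ w = β t ∧ ‖w - x₀‖ ≤ C * ‖β t - x‖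
        · exact ⟨h.choose, fun _ => h.choose_spec⟩
        · exact ⟨0, fun h' => absurd h' h⟩
      choose z hz using this
      exact ⟨z, hex.mono fun t ht => hz t ht⟩
    have hzO : (fun t => z t - x₀) =O[𝓝 0] fun t : ℝ => t :=
      (IsBigO.of_bound C (hz.mono fun t ht => ht.2)).trans hβO
    have hzt : Tendsto z (𝓝 0) (𝓝 x₀) := by
      have := hzO.trans_tendsto (tendsto_id (α := ℝ))
      simpa using this.add_const x₀
    have h3 : (fun t => φ (z t) - φ x₀ - fderiv ℝ φ x₀ (z t - x₀)) =o[𝓝 0] fun t : ℝ => t :=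
      (hD.isLittleO.comp_tendsto hzt).trans_isBigO hzO
    have h4 : (fun t => Φ (φ (z t) - φ x₀ - fderiv ℝ φ x₀ (z t - x₀)))
        =o[𝓝 0] fun t : ℝ => t := (Φ.isBigO_comp _ _).trans_isLittleO h3
    have h5 : (fun t => γ t - γ 0 - t • v) =o[𝓝 0] fun t : ℝ => t := by
      simpa using hasDerivAt_iff_isLittleO.1 hγ
    obtain ⟨w, hw⟩ := mem_range_of_isLittleO (Φ.comp (fderiv ℝ φ x₀)) (fun t => z t - x₀) v (by
      refine ((h5.sub h4).congr' ?_ EventuallyEq.rfl).mono nhdsWithin_le_nhds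
      filter_upwards [hz, hIcc] with t ht ht'
      rw [ht.1, map_sub, map_sub, hβ t ht', hx₀, hγ0, ContinuousLinearMap.comp_apply]
      abel)
    exact ⟨w, hw⟩
  · rintro _ ⟨w, rfl⟩
    obtain ⟨h1, h2⟩ := contDiff_hasDerivAt_comp_line φ hφ x₀ w
    refine Submodule.subset_span ⟨fun t => Φ (φ (x₀ + t • w)), ?_, ?_, ?_, ?_⟩
    · exact (Φ.contDiff.comp h1).contDiffOn
    · exact fun t _ => ⟨_, hφM _, rfl⟩
    · simp [hx₀]
    · exact Φ.hasFDerivAt.comp_hasDerivAt (0 : ℝ) h2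

theorem IsSmoothSubmanifold.tangentSubspace_image {k : ℕ} {M : Set E}
    (hM : IsSmoothSubmanifold k M) {x : E} (hx : x ∈ M)
    (Φ : E →L[ℝ] F) {l : ℝ} (hl : 0 < l) (hΦ : ∀ y ∈ M, l * ‖y - x‖ ≤ ‖Φ y - Φ x‖) :
    tangentSubspace (Φ '' M) (Φ x) = (tangentSubspace M x).map Φ.toLinearMap := by
  obtain ⟨φ, x₀, hφ, hx₀, hφM, C, hC⟩ := hM.exists_parametrization hx
  have h1 := tangentSubspace_image_eq_range hφ hx₀ hφM hC Φ hl hΦ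
  have h2 := tangentSubspace_image_eq_range hφ hx₀ hφM hC (ContinuousLinearMap.id ℝ E) one_pos
    (by simp)
  simp only [ContinuousLinearMap.id_apply, ContinuousLinearMap.id_comp,
    ContinuousLinearMap.coe_id', Set.image_id] at h2
  rw [h1, h2, ContinuousLinearMap.toLinearMap_comp, LinearMap.range_comp]

/-- Every tangent vector of a submanifold is the velocity of a curve in it. -/
theorem IsSmoothSubmanifold.exists_curve {k : ℕ} {M : Set E}
    (hM : IsSmoothSubmanifold k M) {x : E} (hx : x ∈ M) {a : E} (ha : a ∈ tangentSubspace M x) :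
    ∃ γ : ℝ → E, (∀ t, γ t ∈ M) ∧ γ 0 = x ∧ HasDerivAt γ a 0 := by
  obtain ⟨φ, x₀, hφ, hx₀, hφM, C, hC⟩ := hM.exists_parametrization hx
  have h2 := tangentSubspace_image_eq_range hφ hx₀ hφM hC (ContinuousLinearMap.id ℝ E) one_pos
    (by simp)
  simp only [ContinuousLinearMap.id_apply, ContinuousLinearMap.id_comp,
    ContinuousLinearMap.coe_id', Set.image_id] at h2
  rw [h2] at ha
  obtain ⟨w, rfl⟩ := ha
  exact ⟨_, fun t => hφM _, by simp [hx₀], (contDiff_hasDerivAt_comp_line φ hφ x₀ w).2⟩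

/-- A lower Lipschitz bound on a submanifold passes to its tangent vectors. -/
theorem IsSmoothSubmanifold.le_norm_map_tangent {k : ℕ} {M : Set E}
    (hM : IsSmoothSubmanifold k M) {x : E} (hx : x ∈ M)
    (Φ : E →L[ℝ] F) {l : ℝ} (hΦ : ∀ y ∈ M, l * ‖y - x‖ ≤ ‖Φ y - Φ x‖)
    {a : E} (ha : a ∈ tangentSubspace M x) : l * ‖a‖ ≤ ‖Φ a‖ := by
  obtain ⟨γ, hγM, hγ0, hγ⟩ := hM.exists_curve hx ha
  have h1 := (hasDerivAt_iff_tendsto_slope.1 hγ).norm.const_mul l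
  have h2 := (hasDerivAt_iff_tendsto_slope.1 (Φ.hasFDerivAt.comp_hasDerivAt (0 : ℝ) hγ)).norm
  refine le_of_tendsto_of_tendsto' h1 h2 fun t => ?_
  simp only [slope_def_module, norm_smul, hγ0, Function.comp]
  rw [mul_left_comm]
  exact mul_le_mul_of_nonneg_left (hΦ _ (hγM t)) (norm_nonneg _)

/-! ### Nearest points and Federer's inequality. -/

/-- First variation: the squared distance from `z` along any curve in `M` through `y` is minimal at
time 0. -/
theorem sub_mem_normalSubspace {M : Set E} {z y : E}
    (hmin : ∀ w ∈ M, ‖z - y‖ ≤ ‖z - w‖) : z - y ∈ normalSubspace M y := by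
  rw [normalSubspace, Submodule.mem_orthogonal]
  intro a ha
  refine Submodule.span_induction (p := fun a _ => inner ℝ a (z - y) = 0) ?_ (by simp)
    (fun a b _ _ h1 h2 => by rw [inner_add_left, h1, h2, add_zero])
    (fun c a _ h => by rw [inner_smul_left, h, mul_zero]) ha
  rintro v ⟨γ, -, hγM, hγ0, hγ⟩
  have h1 : HasDerivAt (fun t => ‖z - γ t‖ ^ 2) (2 * inner ℝ (z - γ 0) (-v)) 0 :=
    (hγ.const_sub z).norm_sq
  have h2 : IsLocalMin (fun t => ‖z - γ t‖ ^ 2) 0 := by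
    filter_upwards [Icc_mem_nhds (a := (-1 : ℝ)) (b := 1) (x := 0) (by simp) (by simp)] with t ht
    rw [hγ0]
    exact pow_le_pow_left₀ (norm_nonneg _) (hmin _ (hγM t ht)) 2
  have h3 := h2.hasDerivAt_eq_zero h1
  rw [hγ0, inner_neg_right, real_inner_comm] at h3
  linarith

/-- Federer's inequality: chords of `M` leave the tangent spaces at most quadratically. -/
theorem NormalBundleEmbedded.inner_le {M : Set E} (hMc : IsCompact M) {r s : ℝ}
    (hr : NormalBundleEmbedded M r) (hs : 0 < s) (hsr : s < r) {x w v : E} (hx : x ∈ M)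
    (hw : w ∈ M) (hv : v ∈ normalSubspace M x) :
    2 * s * inner ℝ (w - x) v ≤ ‖v‖ * ‖w - x‖ ^ 2 := by
  rcases eq_or_ne v 0 with rfl | hv0
  · simp
  have hvn : 0 < ‖v‖ := norm_pos_iff.2 hv0
  set n : E := (s / ‖v‖) • v with hn
  have hnn : ‖n‖ = s := by
    rw [hn, norm_smul, Real.norm_of_nonneg (by positivity)]; field_simp
  obtain ⟨y, hyM, hy⟩ := hMc.exists_infDist_eq_dist ⟨x, hx⟩ (x + n)
  have hmin : ∀ w ∈ M, ‖x + n - y‖ ≤ ‖x + n - w‖ := fun w hw => by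
    rw [← dist_eq_norm, ← hy, ← dist_eq_norm]
    exact Metric.infDist_le_dist_of_mem hw
  obtain ⟨-, g, -, hg⟩ := hr
  -- Both `(x, n)` and `(y, x + n - y)` lie in the bundle and have endpoint `x + n`, so injectivity
  -- makes `x` the nearest point.
  have h1 := hg (x, n) ⟨hx, Submodule.smul_mem _ _ hv, by simpa [hnn] using hsr⟩
  have h2 := hg (y, x + n - y) ⟨hyM, sub_mem_normalSubspace hmin, by
    have := hmin x hx
    rw [add_sub_cancel_left, hnn] at this
    exact this.trans_lt hsr⟩
  have hyx : y = x := by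
    simp only [add_sub_cancel] at h2
    exact congrArg Prod.fst (h2.symm.trans h1)
  have h3 := hmin w hw
  rw [hyx, add_sub_cancel_left] at h3
  have h4 : ‖n‖ ^ 2 ≤ ‖n - (w - x)‖ ^ 2 := by
    rw [show n - (w - x) = x + n - w by abel]
    exact pow_le_pow_left₀ (norm_nonneg _) h3 2
  rw [norm_sub_sq_real, hn, real_inner_comm, inner_smul_right] at h4
  have h5 : 2 * (s / ‖v‖ * inner ℝ (w - x) v) ≤ ‖w - x‖ ^ 2 := by linarith
  have h6 := mul_le_mul_of_nonneg_left h5 hvn.le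
  calc _ = ‖v‖ * (2 * (s / ‖v‖ * inner ℝ (w - x) v)) := by field_simp
    _ ≤ _ := h6

/-! ### Variation of the tangent space along `M`. -/

/-- A compact set all of whose chords satisfy Federer's inequality stays quadratically close to the
line through `p` in the direction `a` of a curve through `p`. -/
theorem infDist_line_le {M : Set E} (hMc : IsCompact M) {s C : ℝ} (hs : 0 < s)
    (hC : 1 < C * s)
    (hF : ∀ x ∈ M, ∀ w ∈ M, ∀ v ∈ normalSubspace M x,
      2 * s * inner ℝ (w - x) v ≤ ‖v‖ * ‖w - x‖ ^ 2)
    {p a : E} (ha : ‖a‖ = 1) {γ : ℝ → E} (hγM : ∀ t, γ t ∈ M) (hγ0 : γ 0 = p)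
    (hγ : HasDerivAt γ a 0) {T : ℝ} (hT : 0 < T) :
    Metric.infDist (p + T • a) M ≤ C * T ^ 2 := by
  have hp : p ∈ M := hγ0 ▸ hγM 0
  have hC0 : 0 < C := pos_of_mul_pos_left (one_pos.trans hC) hs.le
  set D : ℝ → ℝ := fun t => Metric.infDist (p + t • a) M with hD
  have key : ∀ η : ℝ, 0 < η → D T ≤ C * T ^ 2 + η * T := by
    intro η hη
    obtain ⟨ε, hε, hεT, hDε⟩ : ∃ ε, 0 < ε ∧ ε < T ∧ D ε ≤ η * ε := by
      have h1 : ∀ᶠ t : ℝ in 𝓝[>] 0, ‖γ t - γ 0 - (t - 0) • a‖ ≤ η * ‖t - 0‖ :=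
        ((hasDerivAt_iff_isLittleO.1 hγ).def hη).filter_mono nhdsWithin_le_nhds
      obtain ⟨ε, h2, h3, h4⟩ := (h1.and (Ioo_mem_nhdsGT hT)).exists
      refine ⟨ε, h3, h4, (Metric.infDist_le_dist_of_mem (hγM ε)).trans ?_⟩
      rw [dist_eq_norm, norm_sub_rev, ← sub_sub, ← hγ0]
      simpa [abs_of_pos h3] using h2
    have hnear : ∀ t : ℝ, ∃ w ∈ M, D t = ‖p + t • a - w‖ := fun t => by
      obtain ⟨w, hw, h⟩ := hMc.exists_infDist_eq_dist ⟨p, hp⟩ (p + t • a)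
      exact ⟨w, hw, by rw [hD, ← dist_eq_norm]; exact h⟩
    choose w hwM hw using hnear
    have hDle : ∀ t, ∀ y ∈ M, D t ≤ ‖p + t • a - y‖ := fun t y hy => by
      rw [← dist_eq_norm]; exact Metric.infDist_le_dist_of_mem hy
    have hDnn : ∀ t, 0 ≤ D t := fun t => Metric.infDist_nonneg
    -- Barrier argument for `D ^ 2`. The slack `η * t` gives the initial inequality at `ε > 0`,
    -- because `γ` is tangent to the line.
    have hcmp := image_le_of_liminf_slope_right_lt_deriv_boundary'
      (f := fun t => D t ^ 2) (f' := fun t => 2 * inner ℝ a (p + t • a - w t)) (a := ε) (b := T)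
      (B := fun t => (C * t ^ 2 + η * t) ^ 2)
      (B' := fun t => 2 * (C * t ^ 2 + η * t) * (2 * C * t + η)) ?_ ?_ ?_ ?_ ?_ ?_
      (Set.right_mem_Icc.2 hεT.le)
    · exact (sq_le_sq₀ (hDnn _) (by positivity)).1 hcmp
    · have : Continuous D := (Metric.continuous_infDist_pt M).comp (by fun_prop)
      exact (this.pow 2).continuousOn
    · intro t _ r hr
      apply Eventually.frequently
      have : Tendsto (fun z : ℝ => 2 * inner ℝ a (p + t • a - w t) + (z - t)) (𝓝[>] t)
          (𝓝 (2 * inner ℝ a (p + t • a - w t) + (t - t))) :=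
        (Continuous.tendsto (by fun_prop) t).mono_left nhdsWithin_le_nhds
      rw [sub_self, add_zero] at this
      filter_upwards [this.eventually (gt_mem_nhds hr), self_mem_nhdsWithin] with z hz hzt
      have hzt : t < z := hzt
      refine lt_of_le_of_lt ?_ hz
      rw [slope_def_field, div_le_iff₀ (sub_pos.2 hzt)]
      -- Freezing the nearest point `w t` bounds `D z ^ 2` by a quadratic in `z`, although `D` may
      -- fail to be differentiable.
      have h1 := pow_le_pow_left₀ (hDnn z) (hDle z (w t) (hwM t)) 2
      rw [show p + z • a - w t = (p + t • a - w t) + (z - t) • a by rw [sub_smul]; abel,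
        norm_add_sq_real, norm_smul, ha, inner_smul_right, real_inner_comm, ← hw t,
        Real.norm_eq_abs, mul_one, sq_abs] at h1
      nlinarith
    · refine pow_le_pow_left₀ (hDnn _) (hDε.trans ?_) 2
      have : 0 ≤ C * ε ^ 2 := by positivity
      linarith
    · fun_prop
    · intro t _
      apply HasDerivAt.hasDerivWithinAt
      have h1 : HasDerivAt (fun t : ℝ => C * t ^ 2 + η * t) (2 * C * t + η) t := by
        have := ((hasDerivAt_pow 2 t).const_mul C).add ((hasDerivAt_id t).const_mul η)
        refine this.congr_deriv ?_
        simp; ring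
      refine (h1.pow 2).congr_deriv ?_
      simp
    · intro t ht hDB
      have ht0 : 0 < t := hε.trans_le ht.1
      have hDt : D t = C * t ^ 2 + η * t := by
        exact (pow_left_inj₀ (hDnn t) (by positivity) two_ne_zero).1 hDB
      have hDpos : 0 < D t := by rw [hDt]; positivity
      set ν := p + t • a - w t with hν
      have hνN : ν ∈ normalSubspace M (w t) :=
        sub_mem_normalSubspace fun y hy => by rw [← hν, ← hw t]; exact hDle t y hy
      have hpw : p - w t = ν - t • a := by rw [hν]; abel
      -- Federer's inequality at the foot point, for the chord back to `p`, bounds the growth rate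
      -- of `D ^ 2` where it meets the barrier.
      have h1 := hF (w t) (hwM t) p hp (-ν) (Submodule.neg_mem _ hνN)
      have hDt' : D t ≤ t := by
        have := hDle t p hp
        rwa [add_sub_cancel_left, norm_smul, ha, mul_one, Real.norm_of_nonneg ht0.le] at this
      rw [hpw, norm_neg, norm_sub_sq_real, inner_neg_right, inner_sub_left, inner_smul_left,
        real_inner_self_eq_norm_sq, inner_smul_right, real_inner_comm ν a, norm_smul, ha,
        Real.norm_of_nonneg ht0.le, ← hw t] at h1
      simp only [conj_trivial, mul_one] at h1
      set i : ℝ := inner ℝ a ν with hi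
      rw [real_inner_comm] at h1
      have hgoal : i < D t * (2 * C * t + η) := by
        rcases le_or_gt i 0 with hi0 | hi0
        · exact hi0.trans_lt (by positivity)
        · have h2 : 2 * s * (t * i - D t ^ 2) ≤ D t * (2 * t ^ 2) := by
            have : D t ^ 2 - 2 * (t * i) + t ^ 2 ≤ 2 * t ^ 2 := by
              nlinarith [mul_pos ht0 hi0]
            nlinarith [mul_le_mul_of_nonneg_left this hDpos.le]
          have h3 : D t * t ^ 2 < s * (C * (D t * t ^ 2)) := by
            have : 0 < D t * t ^ 2 := by positivity
            nlinarith
          have h4 : s * (t * i) < s * (D t ^ 2 + C * (D t * t ^ 2)) := by nlinarith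
          have h5 := lt_of_mul_lt_mul_left h4 hs.le
          refine lt_of_mul_lt_mul_left (a := t) ?_ ht0.le
          calc t * i < D t * D t + C * (D t * t ^ 2) := by rw [← sq]; exact h5
            _ = D t * (C * t ^ 2 + η * t) + C * (D t * t ^ 2) := by rw [← hDt]
            _ = _ := by ring
      calc 2 * i < 2 * (D t * (2 * C * t + η)) := by linarith
        _ = _ := by rw [← hDt]; ring
  refine le_of_forall_pos_le_add fun e he => ?_
  have := key (e / T) (by positivity)
  rwa [div_mul_cancel₀ _ hT.ne'] at this

/-- Tangent vectors at `p` are nearly tangent at `q`. -/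
theorem inner_tangent_normal_le {k : ℕ} {M : Set E} (hM : IsSmoothSubmanifold k M)
    (hMc : IsCompact M) {s : ℝ} (hs : 0 < s)
    (hF : ∀ x ∈ M, ∀ w ∈ M, ∀ v ∈ normalSubspace M x,
      2 * s * inner ℝ (w - x) v ≤ ‖v‖ * ‖w - x‖ ^ 2)
    {p q a v : E} (hp : p ∈ M) (hq : q ∈ M) (ha : a ∈ tangentSubspace M p)
    (hv : v ∈ normalSubspace M q) :
    inner ℝ a v ≤ 5 * ‖p - q‖ / s * ‖a‖ * ‖v‖ := by
  rcases le_or_gt 1 (5 * ‖p - q‖ / s) with hbig | hsmall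
  · calc inner ℝ a v ≤ ‖a‖ * ‖v‖ := real_inner_le_norm _ _
      _ ≤ 5 * ‖p - q‖ / s * (‖a‖ * ‖v‖) := le_mul_of_one_le_left (by positivity) hbig
      _ = _ := by ring
  rcases eq_or_ne p q with rfl | hpq
  · rw [(Submodule.mem_orthogonal _ _).1 hv a ha]; positivity
  rcases eq_or_ne a 0 with rfl | ha0
  · simp
  set d := ‖p - q‖ with hd
  have hdpos : 0 < d := norm_pos_iff.2 (sub_ne_zero.2 hpq)
  have han : 0 < ‖a‖ := norm_pos_iff.2 ha0
  set e := ‖a‖⁻¹ • a with he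
  have hen : ‖e‖ = 1 := by rw [he, norm_smul, norm_inv, norm_norm, inv_mul_cancel₀ han.ne']
  suffices h : inner ℝ e v ≤ 5 * d / s * ‖v‖ by
    have h1 : inner ℝ a v = ‖a‖ * inner ℝ e v := by
      rw [he, inner_smul_left]; simp [han.ne']
    rw [h1]
    calc _ ≤ ‖a‖ * (5 * d / s * ‖v‖) := mul_le_mul_of_nonneg_left h han.le
      _ = _ := by ring
  obtain ⟨γ, hγM, hγ0, hγ⟩ := hM.exists_curve hp (Submodule.smul_mem _ ‖a‖⁻¹ ha)
  obtain ⟨w, hwM, hw⟩ := hMc.exists_infDist_eq_dist ⟨p, hp⟩ (p + d • e)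
  -- Any `C > 1 / s` is admissible here; the step length `d` matches the chord `p - q`.
  have hν := infDist_line_le hMc (C := 5 / (4 * s)) hs (by field_simp; norm_num) hF hen hγM hγ0 hγ
    hdpos
  rw [hw, dist_eq_norm] at hν
  set ν := p + d • e - w with hνdef
  have hds : 5 * d < s := by rwa [div_lt_one hs] at hsmall
  have hν2 : ‖ν‖ ≤ d / 4 := by
    refine hν.trans ?_
    rw [div_mul_eq_mul_div, div_le_div_iff₀ (by positivity) (by norm_num)]
    nlinarith
  have hwq : ‖w - q‖ ≤ 9 / 4 * d := by
    have : w - q = (p - q) + d • e - ν := by rw [hνdef]; abel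
    rw [this]
    refine (norm_sub_le _ _).trans ?_
    have h1 := norm_add_le (p - q) (d • e)
    rw [norm_smul, hen, Real.norm_of_nonneg hdpos.le, ← hd] at h1
    linarith
  have h1 := hF q hq w hwM v hv
  have h2 := hF q hq p hp (-v) (Submodule.neg_mem _ hv)
  have h3 := real_inner_le_norm ν v
  rw [inner_neg_right, norm_neg, ← hd] at h2
  -- Federer's inequality at `q` handles the first two terms; after scaling by `s`, the coefficients
  -- 81/32 + 1/2 + 5/4 stay below 5.
  have hsum : d * inner ℝ e v = inner ℝ (w - q) v - inner ℝ (p - q) v + inner ℝ ν v := by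
    rw [← inner_sub_left, ← inner_add_left, hνdef,
      show w - q - (p - q) + (p + d • e - w) = d • e by abel, real_inner_smul_left e v]
  have hwq2 : ‖w - q‖ ^ 2 ≤ 81 / 16 * d ^ 2 := by
    calc _ ≤ (9 / 4 * d) ^ 2 := pow_le_pow_left₀ (norm_nonneg _) hwq 2
      _ = _ := by ring
  have hν3 : s * ‖ν‖ ≤ 5 / 4 * d ^ 2 := by
    calc s * ‖ν‖ ≤ s * (5 / (4 * s) * d ^ 2) := mul_le_mul_of_nonneg_left hν hs.le
      _ = _ := by field_simp
  have h4 := mul_le_mul_of_nonneg_left hwq2 (norm_nonneg v)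
  have h5 := mul_le_mul_of_nonneg_right hν3 (norm_nonneg v)
  have h6 := mul_le_mul_of_nonneg_left h3 hs.le
  have h7 : 0 ≤ d ^ 2 * ‖v‖ := by positivity
  have h8 : (d * s) * inner ℝ e v ≤ (d * s) * (5 * d / s * ‖v‖) := by
    calc (d * s) * inner ℝ e v = s * (d * inner ℝ e v) := by ring
      _ ≤ 5 * (d ^ 2 * ‖v‖) := by rw [hsum]; nlinarith
      _ = _ := by field_simp
  exact le_of_mul_le_mul_left h8 (by positivity)

/-- The witness is the orthogonal projection of `a`; its residual is normal at `q`, and pairing it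
with `a` gives its squared norm. -/
theorem exists_tangent_near [FiniteDimensional ℝ E] {k : ℕ} {M : Set E}
    (hM : IsSmoothSubmanifold k M)
    (hMc : IsCompact M) {s : ℝ} (hs : 0 < s)
    (hF : ∀ x ∈ M, ∀ w ∈ M, ∀ v ∈ normalSubspace M x,
      2 * s * inner ℝ (w - x) v ≤ ‖v‖ * ‖w - x‖ ^ 2)
    {p q a : E} (hp : p ∈ M) (hq : q ∈ M) (ha : a ∈ tangentSubspace M p) :
    ∃ b ∈ tangentSubspace M q, ‖a - b‖ ≤ 5 * ‖p - q‖ / s * ‖a‖ := by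
  set K := tangentSubspace M q
  refine ⟨K.starProjection a, K.starProjection_apply_mem a, ?_⟩
  have hv : a - K.starProjection a ∈ Kᗮ := K.sub_starProjection_mem_orthogonal a
  have h1 := inner_tangent_normal_le hM hMc hs hF hp hq ha hv
  have h2 : inner ℝ a (a - K.starProjection a) = ‖a - K.starProjection a‖ ^ 2 := by
    have h3 := (Submodule.mem_orthogonal _ _).1 hv _ (K.starProjection_apply_mem a)
    rw [← real_inner_self_eq_norm_sq, inner_sub_left, h3, sub_zero]
  rw [h2] at h1
  rcases (norm_nonneg (a - K.starProjection a)).eq_or_lt with h0 | h0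
  · rw [← h0]; positivity
  · rw [sq] at h1
    exact le_of_mul_le_mul_right h1 h0

/-! ### Angles between subspaces. -/

theorem bddAbove_cos_angle (B : Submodule ℝ E) (a : E) :
    BddAbove (Set.range fun b : {b : E // b ∈ B ∧ b ≠ 0} =>
      Real.cos (InnerProductGeometry.angle a (b : E))) :=
  ⟨1, by rintro _ ⟨b, rfl⟩; exact Real.cos_le_one _⟩

theorem iSup_cos_angle_mem (B : Submodule ℝ E) (a : E) :
    (⨆ b : {b : E // b ∈ B ∧ b ≠ 0}, Real.cos (InnerProductGeometry.angle a (b : E)))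
      ∈ Set.Icc (0 : ℝ) 1 := by
  refine ⟨?_, Real.iSup_le (fun b => Real.cos_le_one _) zero_le_one⟩
  rcases isEmpty_or_nonempty {b : E // b ∈ B ∧ b ≠ 0} with h | ⟨⟨b, hb, hb0⟩⟩
  · rw [Real.iSup_of_isEmpty]
  · rcases le_total 0 (Real.cos (InnerProductGeometry.angle a b)) with h | h
    · exact h.trans (le_ciSup (bddAbove_cos_angle B a) ⟨b, hb, hb0⟩)
    · refine le_trans ?_ (le_ciSup (bddAbove_cos_angle B a)
        ⟨-b, B.neg_mem hb, neg_ne_zero.2 hb0⟩)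
      simp only [InnerProductGeometry.angle_neg_right, Real.cos_pi_sub]
      linarith

theorem cos_subspaceAngle (A B : Submodule ℝ E) :
    Real.cos (subspaceAngle A B) = ⨅ a : {a : E // a ∈ A ∧ a ≠ 0},
      ⨆ b : {b : E // b ∈ B ∧ b ≠ 0}, Real.cos (InnerProductGeometry.angle (a : E) (b : E)) := by
  have h0 : 0 ≤ ⨅ a : {a : E // a ∈ A ∧ a ≠ 0},
      ⨆ b : {b : E // b ∈ B ∧ b ≠ 0}, Real.cos (InnerProductGeometry.angle (a : E) (b : E)) :=
    Real.iInf_nonneg fun a => (iSup_cos_angle_mem B a).1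
  refine Real.cos_arccos (by linarith) ?_
  rcases isEmpty_or_nonempty {a : E // a ∈ A ∧ a ≠ 0} with h | ⟨⟨a⟩⟩
  · rw [Real.iInf_of_isEmpty]; exact zero_le_one
  · exact (ciInf_le ⟨0, by rintro _ ⟨a, rfl⟩; exact (iSup_cos_angle_mem B a).1⟩ a).trans
      (iSup_cos_angle_mem B a).2

/-- An empty infimum is 0 by default, so for zero tangent spaces the two cosines agree, matching the
convention for `k = 0`. -/
theorem cos_subspaceAngle_bot (B : Submodule ℝ E) :
    Real.cos (subspaceAngle ⊥ B) = 0 := by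
  rw [cos_subspaceAngle]
  have : IsEmpty {a : E // a ∈ (⊥ : Submodule ℝ E) ∧ a ≠ 0} :=
    ⟨fun a => a.2.2 (by simpa using a.2.1)⟩
  exact Real.iInf_of_isEmpty _

theorem one_sub_sq_le_cos_subspaceAngle {A B : Submodule ℝ E} (hA : A ≠ ⊥) {c : ℝ} (hc : 0 ≤ c)
    (h : ∀ a ∈ A, ∃ b ∈ B, ‖a - b‖ ≤ c * ‖a‖) :
    1 - c ^ 2 ≤ Real.cos (subspaceAngle A B) := by
  rw [cos_subspaceAngle]
  obtain ⟨a₀, ha₀, ha₀0⟩ := A.ne_bot_iff.1 hA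
  have : Nonempty {a : E // a ∈ A ∧ a ≠ 0} := ⟨⟨a₀, ha₀, ha₀0⟩⟩
  refine le_ciInf ?_
  rintro ⟨a, ha, ha0⟩
  rcases le_or_gt 1 c with hc1 | hc1
  · refine le_trans ?_ (iSup_cos_angle_mem B a).1
    nlinarith
  obtain ⟨b, hb, hab⟩ := h a ha
  have han : 0 < ‖a‖ := norm_pos_iff.2 ha0
  have hb0 : b ≠ 0 := by
    rintro rfl
    rw [sub_zero] at hab
    nlinarith
  refine le_trans ?_ (le_ciSup (bddAbove_cos_angle B a) ⟨b, hb, hb0⟩)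
  have hbn : 0 < ‖b‖ := norm_pos_iff.2 hb0
  rw [InnerProductGeometry.cos_angle, le_div_iff₀ (by positivity)]
  have h1 := pow_le_pow_left₀ (norm_nonneg _) hab 2
  rw [norm_sub_sq_real] at h1
  have h2 : 0 ≤ 1 - c ^ 2 := by nlinarith
  -- Expanding `‖a - b‖ ^ 2` gives `2⟪a, b⟫ ≥ (1 - c ^ 2) * ‖a‖ ^ 2 + ‖b‖ ^ 2`; AM-GM finishes.
  nlinarith [mul_nonneg h2 (sq_nonneg (‖a‖ - ‖b‖)), sq_nonneg (c * ‖b‖)]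

/-- Subspaces at a small angle are mapped to subspaces at a comparable angle. -/
theorem abs_cos_subspaceAngle_map_sub_le {A B : Submodule ℝ E} (Φ : E →L[ℝ] F) {l c : ℝ}
    (hl : 0 < l) (hΦ : ∀ a ∈ A, l * ‖a‖ ≤ ‖Φ a‖) (hc : 0 ≤ c)
    (h : ∀ a ∈ A, ∃ b ∈ B, ‖a - b‖ ≤ c * ‖a‖) :
    |Real.cos (subspaceAngle (A.map Φ.toLinearMap) (B.map Φ.toLinearMap)) -
      Real.cos (subspaceAngle A B)| ≤ max (c ^ 2) ((‖Φ‖ * c / l) ^ 2) := by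
  rcases eq_or_ne A ⊥ with rfl | hA
  · rw [Submodule.map_bot, cos_subspaceAngle_bot, cos_subspaceAngle_bot, sub_zero, abs_zero]
    positivity
  have hA' : A.map Φ.toLinearMap ≠ ⊥ := by
    obtain ⟨a, ha, ha0⟩ := A.ne_bot_iff.1 hA
    refine (Submodule.ne_bot_iff _).2 ⟨Φ a, ⟨a, ha, rfl⟩, ?_⟩
    exact norm_pos_iff.1 ((mul_pos hl (norm_pos_iff.2 ha0)).trans_le (hΦ a ha))
  have h1 := one_sub_sq_le_cos_subspaceAngle hA hc h
  have h2 := one_sub_sq_le_cos_subspaceAngle (B := B.map Φ.toLinearMap) hA'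
    (c := ‖Φ‖ * c / l) (by positivity) (by
      rintro _ ⟨a, ha, rfl⟩
      obtain ⟨b, hb, hab⟩ := h a ha
      refine ⟨Φ b, ⟨b, hb, rfl⟩, ?_⟩
      calc ‖Φ a - Φ b‖ = ‖Φ (a - b)‖ := by rw [map_sub]
        _ ≤ ‖Φ‖ * (c * ‖a‖) := (Φ.le_opNorm _).trans (by gcongr)
        _ = ‖Φ‖ * c / l * (l * ‖a‖) := by field_simp
        _ ≤ _ := mul_le_mul_of_nonneg_left (hΦ a ha) (by positivity))
  have h3 := Real.cos_le_one (subspaceAngle A B)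
  have h4 := Real.cos_le_one (subspaceAngle (A.map Φ.toLinearMap) (B.map Φ.toLinearMap))
  rw [abs_le]
  constructor
  · linarith [le_max_right (c ^ 2) ((‖Φ‖ * c / l) ^ 2)]
  · linarith [le_max_left (c ^ 2) ((‖Φ‖ * c / l) ^ 2)]

/-! ### Passing to the reach, and the final estimate. -/

theorem exists_normalBundleEmbedded_of_lt_reach {M : Set E} {s : ℝ} (hs : 0 < s)
    (h : ENNReal.ofReal s < reach M) : ∃ r, s < r ∧ NormalBundleEmbedded M r := by
  obtain ⟨R, hR, hsR⟩ := lt_sSup_iff.1 h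
  obtain ⟨r, hr0, hsr, hrR⟩ := ENNReal.lt_iff_exists_real_btwn.1 hsR
  have hr : s < r := (ENNReal.ofReal_lt_ofReal_iff_of_nonneg hs.le).1 hsr
  exact ⟨r, hr, hR r (hs.trans hr) hrR⟩

/-- Passes to the limit `s → R`, with `R = 0` and `R = ∞` included. -/
theorem ofReal_le_ofReal_div_sq {X Y : ℝ} {R : ℝ≥0∞} (hY : 0 < Y)
    (h : ∀ s, 0 < s → ENNReal.ofReal s < R → X * s ^ 2 ≤ Y) :
    ENNReal.ofReal X ≤ ENNReal.ofReal Y / R ^ 2 := by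
  rcases le_or_gt X 0 with hX | hX
  · simp [ENNReal.ofReal_of_nonpos hX]
  have hR : R ≤ ENNReal.ofReal √(Y / X) := by
    refine le_of_forall_lt fun t ht => ?_
    obtain ⟨s, hs0, hts, hsR⟩ := ENNReal.lt_iff_exists_real_btwn.1 ht
    refine hts.trans_le (ENNReal.ofReal_le_ofReal ?_)
    rcases hs0.eq_or_lt with rfl | hs
    · positivity
    · refine Real.le_sqrt_of_sq_le ?_
      rw [le_div_iff₀ hX, mul_comm]
      exact h s hs hsR
  calc ENNReal.ofReal X = ENNReal.ofReal (Y / (Y / X)) := by congr 1; field_simp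
    _ = ENNReal.ofReal Y / ENNReal.ofReal √(Y / X) ^ 2 := by
      rw [← ENNReal.ofReal_pow (by positivity), Real.sq_sqrt (by positivity),
        ENNReal.ofReal_div_of_pos (by positivity)]
    _ ≤ _ := by gcongr

end NearIsometry

theorem mainTheorem4 (n m k : ℕ) (M : Set (EuclideanSpace ℝ (Fin n)))
    (hM : NearIsometry.IsSmoothSubmanifold k M) (hMc : IsCompact M)
    (l u : ℝ) (hl : 0 < l) (hl1 : l ≤ 1) (hu1 : 1 ≤ u)
    (Φ : EuclideanSpace ℝ (Fin n) →L[ℝ] EuclideanSpace ℝ (Fin m))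
    (hΦ : ∀ x ∈ M, ∀ y ∈ M, l * ‖x - y‖ ≤ ‖Φ x - Φ y‖ ∧ ‖Φ x - Φ y‖ ≤ u * ‖x - y‖)
    (p q : EuclideanSpace ℝ (Fin n)) (hp : p ∈ M) (hq : q ∈ M)
    (Δ : ℝ) (hΔ : Δ = max (1 - l ^ 2) (u ^ 2 - 1)) :
    ENNReal.ofReal
        |Real.cos (NearIsometry.subspaceAngle
              (NearIsometry.tangentSubspace (Φ '' M) (Φ p))
              (NearIsometry.tangentSubspace (Φ '' M) (Φ q))) -
            Real.cos (NearIsometry.subspaceAngle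
              (NearIsometry.tangentSubspace M p) (NearIsometry.tangentSubspace M q))| ≤
      ENNReal.ofReal (25 / (4 * l ^ 2)) *
          (ENNReal.ofReal (‖p - q‖ ^ 2) / NearIsometry.reach M ^ 2) *
          ENNReal.ofReal ((max (‖Φ‖ ^ 2) (u ^ 2) + 1) ^ 2) +
        ENNReal.ofReal (18 * max Δ (Real.sqrt Δ) / l ^ 2) := by
  refine le_trans ?_ le_self_add
  rw [hM.tangentSubspace_image hp Φ hl fun y hy => (hΦ y hy p hp).1,
    hM.tangentSubspace_image hq Φ hl fun y hy => (hΦ y hy q hq).1]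
  have hlow : ∀ a ∈ NearIsometry.tangentSubspace M p, l * ‖a‖ ≤ ‖Φ a‖ := fun a ha =>
    hM.le_norm_map_tangent hp Φ (fun y hy => (hΦ y hy p hp).1) ha
  -- Treated apart because the limit lemma needs a positive numerator.
  rcases eq_or_ne p q with rfl | hpq
  · have h := NearIsometry.abs_cos_subspaceAngle_map_sub_le
      (B := NearIsometry.tangentSubspace M p) Φ hl hlow le_rfl fun a ha => ⟨a, ha, by simp⟩
    refine (ENNReal.ofReal_of_nonpos (h.trans (by simp))).trans_le zero_le
  set K := max (‖Φ‖ ^ 2) (u ^ 2) with hK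
  have hK1 : 1 ≤ K := le_max_of_le_right (by nlinarith)
  have hd : 0 < ‖p - q‖ := norm_pos_iff.2 (sub_ne_zero.2 hpq)
  rw [← mul_div_assoc, ← ENNReal.mul_div_right_comm, ← ENNReal.ofReal_mul (by positivity),
    ← ENNReal.ofReal_mul (by positivity)]
  refine NearIsometry.ofReal_le_ofReal_div_sq (by positivity) fun s hs hsR => ?_
  obtain ⟨r, hsr, hr⟩ := NearIsometry.exists_normalBundleEmbedded_of_lt_reach hs hsR
  have h := NearIsometry.abs_cos_subspaceAngle_map_sub_le Φ hl hlow (by positivity) fun a ha =>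
    NearIsometry.exists_tangent_near hM hMc hs
      (fun x hx w hw v hv => hr.inner_le hMc hs hsr hx hw hv) hp hq ha
  rw [← le_div_iff₀ (by positivity)]
  refine h.trans (max_le ?_ ?_)
  · rw [le_div_iff₀ (by positivity)]
    calc (5 * ‖p - q‖ / s) ^ 2 * s ^ 2 = 25 * ‖p - q‖ ^ 2 * 1 := by field_simp; ring
      _ ≤ 25 * ‖p - q‖ ^ 2 * ((K + 1) ^ 2 / (4 * l ^ 2)) := by
        gcongr
        rw [one_le_div (by positivity)]
        nlinarith
      _ = _ := by field_simp
  · rw [le_div_iff₀ (by positivity)]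
    calc (‖Φ‖ * (5 * ‖p - q‖ / s) / l) ^ 2 * s ^ 2
        = 25 / (4 * l ^ 2) * ‖p - q‖ ^ 2 * (4 * ‖Φ‖ ^ 2) := by field_simp; ring
      _ ≤ 25 / (4 * l ^ 2) * ‖p - q‖ ^ 2 * (K + 1) ^ 2 := by
        gcongr
        -- `4 * ‖Φ‖ ^ 2 ≤ 4 * K ≤ (K + 1) ^ 2`.
        nlinarith [le_max_left (‖Φ‖ ^ 2) (u ^ 2), sq_nonneg (K - 1)]
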